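/- Let $\mathbf G$ be a finite Abelian group, $q=|\mathbf G|$. A channel is given by a finite output alphabet $\mathcal Y$ and conditional probabilities $W(y|x)$, $x\in\mathbf G$, $y\in\mathcal Y$. For $d\in\mathbf G$ put $$Z_d(W)=\frac1q\sum_{x\in\mathbf G}\sum_{y\in\mathcal Y}\sqrt{W(y|x)\,W(y|x+d)} ,$$ and define the channels $$W^-(y_1,y_2|u_1)=\sum_{u_2'\in\mathbf G}\frac1q W(y_1|u_1+u_2')W(y_2|u_2'),\qquad W^+(y_1,y_2,u_1|u_2)=\frac1q W(y_1|u_1+u_2)W(y_2|u_2).$$ Let $W_1^{(1)}=W$ and, for $N=2^n$ and $1\le i\le N$, $W_{2N}^{(2i-1)}=(W_N^{(i)})^-$ and $W_{2N}^{(2i)}=(W_N^{(i)})^+$. Let $B_1,B_2,\dots$ be independent fair bits, let $J_n=1+\sum_{k=1}^n B_k2^{n-k}$, which is uniform on $\{1,\dots,2^n\}$, and let $Z_d^n(W)=Z_d(W_{2^n}^{(J_n)})$. Then for every channel $W$ with input alphabet $\mathbf G$: (1) for every $d\in\mathbf G$, $Z_d^n(W)$ converges almost surely, as $n\to\infty$,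 to a $\{0,1\}$-valued random variable $Z_d^\infty(W)$; (2) if $d,\tilde d\in\mathbf G$ generate the same subgroup, $\langle\tilde d\rangle=\langle d\rangle$, then $Z_{\tilde d}^\infty(W)=Z_d^\infty(W)$ almost surely; (3) almost surely there is exactly one subgroup $H\le\mathbf G$ such that, for all $d\in\mathbf G$, $Z_d^\infty(W)=1$ if $d\in H$ and $Z_d^\infty(W)=0$ if $d\notin H$ ("case $H$"). Moreover, every case is possible: for each subgroup $H\le\mathbf G$ there is a channel with input alphabet $\mathbf G$ for which case $H$ occurs almost surely. -/

import Mathlib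

open MeasureTheory ProbabilityTheory Filter Topology

universe u v

/-- A discrete memoryless channel with input alphabet `X` and a finite output alphabet `Out`:
`prob x y` is the transition probability `W(y|x)`. -/
structure Channel (X : Type u) where
  /-- the output alphabet -/
  Out : Type v
  /-- the output alphabet is finite -/
  fintypeOut : Fintype Out
  /-- the conditional probability law `W(y|x)` -/
  prob : X → Out → ℝ
  prob_nonneg : ∀ x y, 0 ≤ prob x y
  sum_prob : ∀ x, ∑ y, prob x y = 1

attribute [instance] Channel.fintypeOut

namespace Channel

/-- The transform `W⁻(y₁,y₂|u₁) = ∑_{u₂'} (1/q) W(y₁|u₁+u₂') W(y₂|u₂')`. -/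
noncomputable def minus {G : Type u} [AddCommGroup G] [Fintype G]
    (W : Channel.{u, max u v} G) : Channel.{u, max u v} G where
  Out := W.Out × W.Out
  fintypeOut := inferInstance
  prob u₁ y := ∑ u₂ : G, 1 / (Fintype.card G : ℝ) * W.prob (u₁ + u₂) y.1 * W.prob u₂ y.2
  prob_nonneg u₁ y := Finset.sum_nonneg fun u₂ _ =>
    mul_nonneg (mul_nonneg (by positivity) (W.prob_nonneg _ _)) (W.prob_nonneg _ _)
  sum_prob u₁ := by
    rw [Finset.sum_comm]
    have h : ∀ u₂ : G, ∑ y : W.Out × W.Out,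
        1 / (Fintype.card G : ℝ) * W.prob (u₁ + u₂) y.1 * W.prob u₂ y.2
          = 1 / (Fintype.card G : ℝ) := by
      intro u₂
      rw [Fintype.sum_prod_type]
      simp only [← Finset.mul_sum, W.sum_prob, mul_one]
    rw [Finset.sum_congr rfl fun u₂ _ => h u₂]
    simp

/-- The transform `W⁺(y₁,y₂,u₁|u₂) = (1/q) W(y₁|u₁+u₂) W(y₂|u₂)`. -/
noncomputable def plus {G : Type u} [AddCommGroup G] [Fintype G]
    (W : Channel.{u, max u v} G) : Channel.{u, max u v} G where
  Out := W.Out × W.Out × G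
  fintypeOut := inferInstance
  prob u₂ y := 1 / (Fintype.card G : ℝ) * W.prob (y.2.2 + u₂) y.1 * W.prob u₂ y.2.1
  prob_nonneg u₂ y :=
    mul_nonneg (mul_nonneg (by positivity) (W.prob_nonneg _ _)) (W.prob_nonneg _ _)
  sum_prob u₂ := by
    have h : ∑ y : W.Out × W.Out × G,
        1 / (Fintype.card G : ℝ) * W.prob (y.2.2 + u₂) y.1 * W.prob u₂ y.2.1
        = ∑ u₁ : G, ∑ y₂ : W.Out, ∑ y₁ : W.Out,
          1 / (Fintype.card G : ℝ) * W.prob u₂ y₂ * W.prob (u₁ + u₂) y₁ := by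
      rw [Fintype.sum_prod_type_right, Fintype.sum_prod_type_right]
      exact Finset.sum_congr rfl fun u₁ _ => Finset.sum_congr rfl fun y₂ _ =>
        Finset.sum_congr rfl fun y₁ _ => by ring
    rw [h]
    simp only [← Finset.mul_sum, W.sum_prob, mul_one]
    simp

/-- The `N = 2ⁿ` channels obtained from `W` by applying the two transforms `n` times.
Indices start at `0`: `W.synth n i` is the channel `W_N^{(i+1)}`, so that
`W_{2N}^{(2i-1)} = (W_N^{(i)})⁻` and `W_{2N}^{(2i)} = (W_N^{(i)})⁺`. -/
noncomputable def synth {G : Type u} [AddCommGroup G] [Fintype G]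
    (W : Channel.{u, max u v} G) : ℕ → ℕ → Channel.{u, max u v} G
  | 0, _ => W
  | n + 1, i => if i % 2 = 0 then (W.synth n (i / 2)).minus else (W.synth n (i / 2)).plus

/-- The parameter `Z_d(W) = (1/q) ∑_x ∑_y √(W(y|x) W(y|x+d))`. -/
noncomputable def Z {G : Type u} [AddCommGroup G] [Fintype G]
    (W : Channel.{u, max u v} G) (d : G) : ℝ :=
  1 / (Fintype.card G : ℝ) * ∑ x : G, ∑ y : W.Out, √(W.prob x y * W.prob (x + d) y)

/-- The (zero-based) index in `{0, …, 2ⁿ - 1}` with binary expansion `b 0, …, b (n-1)`, most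
significant bit first. For independent fair bits it is uniformly distributed. -/
def index (b : ℕ → Bool) : ℕ → ℕ
  | 0 => 0
  | n + 1 => 2 * index b n + (b n).toNat

/-- The process `Z_dⁿ(W) = Z_d(W_N^{(Jₙ)})`, along the bits `b`, where `Jₙ` is the index with
binary expansion `b 0, …, b (n-1)`. -/
noncomputable def Zproc {G : Type u} [AddCommGroup G] [Fintype G]
    (W : Channel.{u, max u v} G) (d : G) (n : ℕ) (b : ℕ → Bool) : ℝ :=
  (W.synth n (index b n)).Z d

end Channel

universe w

namespace Channel

section

variable {G : Type u} [AddCommGroup G] [Fintype G]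

/-! The chain rule `H(W⁻) + H(W⁺) = 2 H(W)` (`condEntropy_minus_add_plus`) makes the conditional
entropy of input given output a bounded martingale along the random path, each step being plus or
minus the gap `H(W⁻) - H(W)`. Orthogonality of increments makes the squared gaps summable in
expectation, so the gap tends to `0` almost surely. Because relative entropy dominates squared
Hellinger distance, the gap is at least `Z_d² (1 - Z_d) / (2q)`
(`Z_sq_mul_one_sub_Z_le_condEntropy_gap`), so each `Z_d` approaches the set `{0, 1}`. Since `Z_d(W⁺)
= Z_d(W)²` and `Z_d(W⁻) ≥ Z_d(W)`, it cannot drop from near `1` to near `0` in one step, hence it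
converges.

As `2 (1 - Z_d)` is a squared Hellinger distance between shifts, the triangle inequality makes the
`d` with limit `1` a subgroup `H`. This gives (3), and (2) because `d ∈ H` depends only on `⟨d⟩`.
Case `H` is realised by the channel revealing the coset of its input modulo `H`. -/

/-- The joint law of a uniform input and the corresponding output. -/
noncomputable def joint (W : Channel.{u, w} G) (x : G) (y : W.Out) : ℝ :=
  1 / (Fintype.card G : ℝ) * W.prob x y

/-- The output law under a uniform input. -/
noncomputable def marginal (W : Channel.{u, w} G) (y : W.Out) : ℝ :=
  ∑ x, W.joint x y

lemma card_cast_pos : (0 : ℝ) < Fintype.card G := by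
  exact_mod_cast Fintype.card_pos

lemma joint_nonneg (W : Channel.{u, w} G) (x : G) (y : W.Out) : 0 ≤ W.joint x y :=
  mul_nonneg (by positivity) (W.prob_nonneg _ _)

lemma marginal_nonneg (W : Channel.{u, w} G) (y : W.Out) : 0 ≤ W.marginal y :=
  Finset.sum_nonneg fun x _ => W.joint_nonneg x y

lemma joint_le_marginal (W : Channel.{u, w} G) (x : G) (y : W.Out) :
    W.joint x y ≤ W.marginal y :=
  Finset.single_le_sum (f := fun x => W.joint x y) (fun x _ => W.joint_nonneg x y)
    (Finset.mem_univ x)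

lemma sum_sum_joint (W : Channel.{u, w} G) : ∑ x, ∑ y, W.joint x y = 1 := by
  have h := (card_cast_pos (G := G)).ne'
  simp [joint, ← Finset.mul_sum, W.sum_prob]

lemma sum_marginal (W : Channel.{u, w} G) : ∑ y, W.marginal y = 1 := by
  rw [← W.sum_sum_joint, Finset.sum_comm]
  rfl

lemma Z_eq_sum_joint (W : Channel.{u, max u v} G) (d : G) :
    W.Z d = ∑ x, ∑ y, √(W.joint x y * W.joint (x + d) y) := by
  simp only [Z, joint, Finset.mul_sum]
  refine Finset.sum_congr rfl fun x _ => Finset.sum_congr rfl fun y _ => ?_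
  rw [mul_mul_mul_comm, Real.sqrt_mul (mul_self_nonneg _), Real.sqrt_mul_self (by positivity)]

lemma joint_minus (W : Channel.{u, max u v} G) (u₁ : G) (y : W.Out × W.Out) :
    (minus.{u, v} W).joint u₁ y = ∑ u₂, W.joint (u₁ + u₂) y.1 * W.joint u₂ y.2 := by
  simp only [joint, minus, Finset.mul_sum]
  exact Finset.sum_congr rfl fun _ _ => by ring

lemma joint_plus (W : Channel.{u, max u v} G) (u₂ : G) (y : W.Out × W.Out × G) :
    (plus.{u, v} W).joint u₂ y = W.joint (y.2.2 + u₂) y.1 * W.joint u₂ y.2.1 := by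
  simp only [joint, plus]
  ring

lemma sum_joint_add_right (W : Channel.{u, w} G) (a : G) (y : W.Out) :
    ∑ x, W.joint (x + a) y = W.marginal y :=
  Equiv.sum_comp (Equiv.addRight a) (fun x => W.joint x y)

lemma marginal_minus (W : Channel.{u, max u v} G) (y : W.Out × W.Out) :
    (minus.{u, v} W).marginal y = W.marginal y.1 * W.marginal y.2 := by
  unfold marginal
  simp only [joint_minus]
  rw [Finset.sum_comm, Finset.mul_sum]
  refine Finset.sum_congr rfl fun u₂ _ => ?_
  rw [← Finset.sum_mul, sum_joint_add_right]
  rfl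

/-- The output of `W⁺` is an input-output pair of `W⁻`; this cancels the middle terms in the chain
rule. -/
lemma marginal_plus (W : Channel.{u, max u v} G) (y : W.Out × W.Out × G) :
    (plus.{u, v} W).marginal y = (minus.{u, v} W).joint y.2.2 (y.1, y.2.1) := by
  rw [joint_minus]
  unfold marginal
  simp only [joint_plus]

/-! ### The parameters `Z_d` -/

lemma Z_nonneg (W : Channel.{u, max u v} G) (d : G) : 0 ≤ W.Z d := by
  rw [Z_eq_sum_joint]
  positivity

lemma sum_sum_joint_add (W : Channel.{u, w} G) (d : G) :
    ∑ x, ∑ y, W.joint (x + d) y = 1 := by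
  rw [← W.sum_sum_joint]
  exact Equiv.sum_comp (Equiv.addRight d) (fun x => ∑ y, W.joint x y)

/-- `2 (1 - Z_d)` is the squared Hellinger distance between the joint law and its shift. -/
lemma two_mul_one_sub_Z (W : Channel.{u, max u v} G) (d : G) :
    2 * (1 - W.Z d) = ∑ x, ∑ y, (√(W.joint x y) - √(W.joint (x + d) y)) ^ 2 := by
  have h : ∀ x y, (√(W.joint x y) - √(W.joint (x + d) y)) ^ 2
      = W.joint x y + W.joint (x + d) y - 2 * √(W.joint x y * W.joint (x + d) y) := by
    intro x y
    rw [Real.sqrt_mul (W.joint_nonneg _ _), sub_sq, Real.sq_sqrt (W.joint_nonneg _ _),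
      Real.sq_sqrt (W.joint_nonneg _ _)]
    ring
  simp only [h, Finset.sum_sub_distrib, Finset.sum_add_distrib, ← Finset.mul_sum,
    sum_sum_joint, sum_sum_joint_add, ← Z_eq_sum_joint.{u, v}]
  ring

lemma Z_le_one (W : Channel.{u, max u v} G) (d : G) : W.Z d ≤ 1 := by
  have h := W.two_mul_one_sub_Z d
  have : 0 ≤ ∑ x, ∑ y, (√(W.joint x y) - √(W.joint (x + d) y)) ^ 2 := by positivity
  linarith

lemma Z_zero (W : Channel.{u, max u v} G) : W.Z 0 = 1 := by
  have h := W.two_mul_one_sub_Z 0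
  simp only [add_zero, sub_self, ne_eq, OfNat.ofNat_ne_zero, not_false_eq_true, zero_pow,
    Finset.sum_const_zero] at h
  linarith

lemma Z_neg (W : Channel.{u, max u v} G) (d : G) : W.Z (-d) = W.Z d := by
  rw [Z_eq_sum_joint, Z_eq_sum_joint, ← Equiv.sum_comp (Equiv.addRight d)]
  simp [mul_comm]

/-- Triangle inequality for the Hellinger distance, via `(s + t)² ≤ 2 s² + 2 t²`. -/
lemma one_sub_Z_add_le (W : Channel.{u, max u v} G) (d e : G) :
    1 - W.Z (d + e) ≤ 2 * (1 - W.Z d) + 2 * (1 - W.Z e) := by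
  have h1 := W.two_mul_one_sub_Z d
  have h2 := W.two_mul_one_sub_Z e
  have h3 := W.two_mul_one_sub_Z (d + e)
  rw [← Equiv.sum_comp (Equiv.addRight d)] at h2
  simp only [Equiv.coe_addRight] at h2
  have : ∑ x, ∑ y, (√(W.joint x y) - √(W.joint (x + (d + e)) y)) ^ 2
      ≤ 2 * ∑ x, ∑ y, (√(W.joint x y) - √(W.joint (x + d) y)) ^ 2
        + 2 * ∑ x, ∑ y, (√(W.joint (x + d) y) - √(W.joint (x + d + e) y)) ^ 2 := by
    simp only [Finset.mul_sum, ← Finset.sum_add_distrib, ← add_assoc]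
    refine Finset.sum_le_sum fun x _ => Finset.sum_le_sum fun y _ => ?_
    nlinarith [sq_nonneg (√(W.joint x y) - √(W.joint (x + d) y)
      - (√(W.joint (x + d) y) - √(W.joint (x + d + e) y)))]
  linarith

/-- Summing over the output component `u₁` lets the first input range over `G` independently of the
second, so the sum factors. -/
lemma Z_plus (W : Channel.{u, max u v} G) (d : G) : (plus.{u, v} W).Z d = W.Z d ^ 2 := by
  rw [Z_eq_sum_joint]
  have h : ∀ (x : G) (y : W.Out × W.Out × G),
      √((plus.{u, v} W).joint x y * (plus.{u, v} W).joint (x + d) y)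
        = √(W.joint (y.2.2 + x) y.1 * W.joint (y.2.2 + x + d) y.1)
          * √(W.joint x y.2.1 * W.joint (x + d) y.2.1) := by
    intro x y
    rw [joint_plus, joint_plus, ← Real.sqrt_mul
      (mul_nonneg (W.joint_nonneg _ _) (W.joint_nonneg _ _)), mul_mul_mul_comm, add_assoc]
  have hs : ∀ x : G, ∑ y : W.Out × W.Out × G,
      √(W.joint (y.2.2 + x) y.1 * W.joint (y.2.2 + x + d) y.1)
          * √(W.joint x y.2.1 * W.joint (x + d) y.2.1)
      = W.Z d * ∑ y, √(W.joint x y * W.joint (x + d) y) := by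
    intro x
    rw [Z_eq_sum_joint, ← Equiv.sum_comp (Equiv.addRight x), Finset.sum_mul_sum]
    simp only [Fintype.sum_prod_type_right]
    refine Finset.sum_congr rfl fun u _ => Finset.sum_congr rfl fun y _ => ?_
    simp only [Equiv.coe_addRight, Finset.sum_mul]
  calc _ = ∑ x, ∑ y : W.Out × W.Out × G,
      √(W.joint (y.2.2 + x) y.1 * W.joint (y.2.2 + x + d) y.1)
          * √(W.joint x y.2.1 * W.joint (x + d) y.2.1) :=
        Finset.sum_congr rfl fun x _ => Finset.sum_congr rfl fun y _ => h x y
    _ = _ := by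
      simp only [hs, ← Finset.mul_sum, ← Z_eq_sum_joint.{u, v}]
      ring

/-- Cauchy–Schwarz over the hidden input `u₂`: mixing over it can only increase the overlap of the
two laws. -/
lemma Z_le_Z_minus (W : Channel.{u, max u v} G) (d : G) : W.Z d ≤ (minus.{u, v} W).Z d := by
  have h : ∀ (x : G) (y : W.Out × W.Out),
      ∑ u₂, √(W.joint (x + u₂) y.1 * W.joint (x + u₂ + d) y.1) * W.joint u₂ y.2
        ≤ √((minus.{u, v} W).joint x y * (minus.{u, v} W).joint (x + d) y) := by
    intro x y
    rw [joint_minus, joint_minus, Real.sqrt_mul (Finset.sum_nonneg fun _ _ =>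
      mul_nonneg (W.joint_nonneg _ _) (W.joint_nonneg _ _))]
    refine le_trans (le_of_eq ?_) (Real.sum_sqrt_mul_sqrt_le _
      (fun u₂ => mul_nonneg (W.joint_nonneg (x + u₂) y.1) (W.joint_nonneg u₂ y.2))
      (fun u₂ => mul_nonneg (W.joint_nonneg (x + d + u₂) y.1) (W.joint_nonneg u₂ y.2)))
    refine Finset.sum_congr rfl fun u₂ _ => ?_
    rw [← Real.sqrt_mul (mul_nonneg (W.joint_nonneg _ _) (W.joint_nonneg _ _)),
      mul_mul_mul_comm, Real.sqrt_mul (mul_nonneg (W.joint_nonneg _ _) (W.joint_nonneg _ _)),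
      Real.sqrt_mul_self (W.joint_nonneg _ _), add_right_comm]
  calc W.Z d = ∑ u₂, ∑ y, W.Z d * W.joint u₂ y := by
        conv_lhs => rw [← mul_one (W.Z d), ← W.sum_sum_joint]
        simp only [Finset.mul_sum]
    _ = ∑ u₂, ∑ x, ∑ y : W.Out × W.Out,
        √(W.joint (x + u₂) y.1 * W.joint (x + u₂ + d) y.1) * W.joint u₂ y.2 := by
      refine Finset.sum_congr rfl fun u₂ _ => ?_
      rw [← Finset.mul_sum, Z_eq_sum_joint, ← Equiv.sum_comp (Equiv.addRight u₂), Finset.sum_mul]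
      refine Finset.sum_congr rfl fun x _ => ?_
      rw [Finset.sum_mul_sum, Fintype.sum_prod_type]
      simp only [Equiv.coe_addRight]
    _ = ∑ x, ∑ y : W.Out × W.Out, ∑ u₂,
        √(W.joint (x + u₂) y.1 * W.joint (x + u₂ + d) y.1) * W.joint u₂ y.2 := by
      rw [Finset.sum_comm]
      exact Finset.sum_congr rfl fun x _ => Finset.sum_comm
    _ ≤ _ := by
      rw [Z_eq_sum_joint]
      exact Finset.sum_le_sum fun x _ => Finset.sum_le_sum fun y _ => h x y

/-! ### The conditional entropy of the input given the output -/

/-- The conditional entropy (in nats) of a uniform input given the output. -/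
noncomputable def condEntropy (W : Channel.{u, w} G) : ℝ :=
  ∑ x, ∑ y, (W.joint x y).negMulLog - ∑ y, (W.marginal y).negMulLog

lemma condEntropy_eq {X : Type u} [Fintype X] (W : Channel.{u, w} X) :
    W.condEntropy = ∑ x, ∑ y, ((W.joint x y).negMulLog
      + W.joint x y * Real.log (W.marginal y)) := by
  simp only [condEntropy, Finset.sum_add_distrib, sub_eq_add_neg, ← Finset.sum_neg_distrib]
  congr 1
  rw [Finset.sum_comm]
  refine Finset.sum_congr rfl fun y _ => ?_
  rw [← Finset.sum_mul, Real.negMulLog, neg_mul, neg_neg]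
  rfl

lemma condEntropy_nonneg (W : Channel.{u, w} G) : 0 ≤ W.condEntropy := by
  rw [condEntropy_eq]
  refine Finset.sum_nonneg fun x _ => Finset.sum_nonneg fun y _ => ?_
  rcases (W.joint_nonneg x y).eq_or_lt with h | h
  · simp [← h]
  · have := mul_le_mul_of_nonneg_left (Real.log_le_log h (W.joint_le_marginal x y)) h.le
    rw [Real.negMulLog]
    linarith

/-- Only a bound uniform in the channel matters, so `log t ≤ t - 1` suffices in place of the sharp
`log q`. -/
lemma condEntropy_le_card (W : Channel.{u, w} G) : W.condEntropy ≤ Fintype.card G := by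
  have hb : ∀ x y, (W.joint x y).negMulLog + W.joint x y * Real.log (W.marginal y)
      ≤ W.marginal y := by
    intro x y
    rcases (W.joint_nonneg x y).eq_or_lt with h | h
    · simpa [← h] using W.marginal_nonneg y
    · have hm := h.trans_le (W.joint_le_marginal x y)
      have h1 := Real.log_le_sub_one_of_pos (div_pos hm h)
      rw [Real.log_div hm.ne' h.ne'] at h1
      have h2 := mul_le_mul_of_nonneg_left h1 h.le
      rw [mul_sub, mul_sub, mul_div_cancel₀ _ h.ne'] at h2
      rw [Real.negMulLog]
      linarith
  rw [condEntropy_eq]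
  refine (Finset.sum_le_sum fun x _ => Finset.sum_le_sum fun y _ => hb x y).trans ?_
  simp [sum_marginal]

lemma sum_negMulLog_mul {α β : Type*} [Fintype α] [Fintype β] (f : α → ℝ) (g : β → ℝ) :
    ∑ a, ∑ b, (f a * g b).negMulLog
      = (∑ b, g b) * ∑ a, (f a).negMulLog + (∑ a, f a) * ∑ b, (g b).negMulLog := by
  simp only [Real.negMulLog_mul, Finset.sum_add_distrib, ← Finset.mul_sum, ← Finset.sum_mul]

/-- The chain rule: the two transforms preserve the total conditional entropy. -/
lemma condEntropy_minus_add_plus (W : Channel.{u, max u v} G) :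
    (minus.{u, v} W).condEntropy + (plus.{u, v} W).condEntropy = 2 * W.condEntropy := by
  -- `(u₁ + u₂, y₁)` and `(u₂, y₂)` are independent copies of the original pair, so the entropy
  -- doubles.
  have hA : ∑ x : G, ∑ y : W.Out × W.Out × G, ((plus.{u, v} W).joint x y).negMulLog
      = 2 * ∑ x, ∑ y, (W.joint x y).negMulLog := by
    have hx : ∀ x : G, ∑ y : W.Out × W.Out × G, ((plus.{u, v} W).joint x y).negMulLog
        = ∑ y₂, ∑ p : G × W.Out, (W.joint p.1 p.2 * W.joint x y₂).negMulLog := by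
      intro x
      simp only [joint_plus.{u, v}, Fintype.sum_prod_type_right]
      rw [Finset.sum_comm]
      refine Finset.sum_congr rfl fun y₂ _ => ?_
      exact (Equiv.sum_comp (Equiv.addRight x)
        (fun u => ∑ y₁, (W.joint u y₁ * W.joint x y₂).negMulLog)).trans Finset.sum_comm
    have h := sum_negMulLog_mul (fun p : G × W.Out => W.joint p.1 p.2)
      (fun p : G × W.Out => W.joint p.1 p.2)
    simp only [Fintype.sum_prod_type, sum_sum_joint, one_mul] at h
    simp only [hx, two_mul, ← h, Fintype.sum_prod_type]
    exact Finset.sum_congr rfl fun _ _ => Finset.sum_congr rfl fun _ _ =>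
      Finset.sum_congr rfl fun _ _ => Finset.sum_congr rfl fun _ _ => by rw [mul_comm]
  have hB : ∑ y : W.Out × W.Out, ((minus.{u, v} W).marginal y).negMulLog
      = 2 * ∑ y, (W.marginal y).negMulLog := by
    simp only [marginal_minus.{u, v}, Fintype.sum_prod_type, sum_negMulLog_mul, sum_marginal]
    ring
  have hC : ∑ y : W.Out × W.Out × G, ((plus.{u, v} W).marginal y).negMulLog
      = ∑ x : G, ∑ y : W.Out × W.Out, ((minus.{u, v} W).joint x y).negMulLog := by
    simp only [marginal_plus.{u, v}, Fintype.sum_prod_type_right]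
  have h1 : (plus.{u, v} W).condEntropy = 2 * ∑ x, ∑ y, (W.joint x y).negMulLog
      - ∑ x : G, ∑ y : W.Out × W.Out, ((minus.{u, v} W).joint x y).negMulLog :=
    congrArg₂ (· - ·) hA hC
  have h2 : (minus.{u, v} W).condEntropy
      = ∑ x : G, ∑ y : W.Out × W.Out, ((minus.{u, v} W).joint x y).negMulLog
        - 2 * ∑ y, (W.marginal y).negMulLog :=
    congrArg₂ (· - ·) rfl hB
  rw [h1, h2, condEntropy]
  ring

/-! ### Lower bound for the entropy gap -/

lemma two_mul_sub_sqrt_le_mul_log {a b m M : ℝ} (ha : 0 ≤ a) (hb : 0 ≤ b) (hbM : b ≤ M)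
    (habm : a * b ≤ m) :
    2 * (a * b - b * (√a * √(m / M)))
      ≤ a * b * (Real.log a + Real.log M - Real.log m) := by
  rcases ha.eq_or_lt with rfl | ha
  · simp
  rcases hb.eq_or_lt with rfl | hb
  · simp
  have hM := hb.trans_le hbM
  have hm := (mul_pos ha hb).trans_le habm
  -- The logarithmic factor is `-2 log t`, so the claim is `log t ≤ t - 1` scaled by `2ab`.
  set t := √(m / M) / √a with ht
  have ht0 : 0 < t := by positivity
  have hlog : Real.log a + Real.log M - Real.log m = - (2 * Real.log t) := by
    rw [ht, Real.log_div (by positivity) (by positivity), Real.log_sqrt (by positivity),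
      Real.log_sqrt ha.le, Real.log_div hm.ne' hM.ne']
    ring
  have h1 := Real.log_le_sub_one_of_pos ht0
  have h2 : √a * √(m / M) = a * t := by
    rw [ht, mul_div_assoc', eq_div_iff (by positivity), mul_right_comm, Real.mul_self_sqrt ha.le]
  rw [hlog, h2]
  nlinarith [mul_pos ha hb]

/-- A weighted variance bound: the mean squared distance to any point `c` controls the
distances between points a fixed shift apart. -/
lemma sum_mul_shift_sq_le {b f : G → ℝ} (hb : ∀ x, 0 ≤ b x) (c : ℝ) (d : G) :
    ∑ x, b x * b (x + d) * (f x - f (x + d)) ^ 2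
      ≤ 4 * (∑ x, b x) * ∑ x, b x * (f x - c) ^ 2 := by
  have hle : ∀ x, b x ≤ ∑ x, b x := fun x =>
    Finset.single_le_sum (fun x _ => hb x) (Finset.mem_univ x)
  have hM : 0 ≤ ∑ x, b x := Finset.sum_nonneg fun x _ => hb x
  have hs : ∑ x, b (x + d) * (f (x + d) - c) ^ 2 = ∑ x, b x * (f x - c) ^ 2 :=
    Equiv.sum_comp (Equiv.addRight d) (fun x => b x * (f x - c) ^ 2)
  calc ∑ x, b x * b (x + d) * (f x - f (x + d)) ^ 2
      ≤ ∑ x, (2 * (∑ x, b x) * (b x * (f x - c) ^ 2)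
          + 2 * (∑ x, b x) * (b (x + d) * (f (x + d) - c) ^ 2)) := by
        refine Finset.sum_le_sum fun x _ => ?_
        have h1 : (f x - f (x + d)) ^ 2 ≤ 2 * (f x - c) ^ 2 + 2 * (f (x + d) - c) ^ 2 := by
          nlinarith [sq_nonneg (f x - c + (f (x + d) - c))]
        have h2 := mul_le_mul_of_nonneg_left h1 (mul_nonneg (hb x) (hb (x + d)))
        have h3 := mul_le_mul_of_nonneg_right (hle (x + d))
          (mul_nonneg (hb x) (sq_nonneg (f x - c)))
        have h4 := mul_le_mul_of_nonneg_right (hle x)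
          (mul_nonneg (hb (x + d)) (sq_nonneg (f (x + d) - c)))
        linarith
    _ = _ := by
      rw [Finset.sum_add_distrib, ← Finset.mul_sum, ← Finset.mul_sum, hs]
      ring

/-- The right side is the `b x`-weighted sum of the relative entropies of the translates `a (· + x)`
from their average `m / M`. Each log term is bounded by a Hellinger-type term, and the mean squared
distance of the `√(a (u + x))` to `√(m u / M)` controls differences across a shift by `d`. -/
lemma sum_sqrt_mul_shift_le_entropy_gap {a b : G → ℝ} (ha : ∀ x, 0 ≤ a x) (hb : ∀ x, 0 ≤ b x)
    (d : G) :
    1 / 4 * ((∑ x, b x * b (x + d) / ∑ x, b x) * ∑ u, (√(a u) - √(a (u + d))) ^ 2)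
      ≤ ∑ u, (∑ x, a (u + x) * b x).negMulLog - ((∑ x, a x) * ∑ x, b x).negMulLog
        - (∑ x, b x) * (∑ x, (a x).negMulLog - (∑ x, a x).negMulLog) := by
  set A := ∑ x, a x with hA
  set M := ∑ x, b x with hM
  set m : G → ℝ := fun u => ∑ x, a (u + x) * b x with hm
  have hM0 : 0 ≤ M := Finset.sum_nonneg fun x _ => hb x
  have hbM : ∀ x, b x ≤ M := fun x => Finset.single_le_sum (fun x _ => hb x) (Finset.mem_univ x)
  rcases hM0.eq_or_lt with hMz | hMpos
  · have hb0 : ∀ x, b x = 0 := fun x => le_antisymm (hMz ▸ hbM x) (hb x)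
    simp [hb0, ← hMz]
  have hshift : ∀ g : G → ℝ, ∑ u, ∑ x, g (u + x) * b x = (∑ u, g u) * M := by
    intro g
    rw [Finset.sum_comm, hM, Finset.mul_sum]
    refine Finset.sum_congr rfl fun x _ => ?_
    rw [← Finset.sum_mul]
    congr 1
    exact Equiv.sum_comp (Equiv.addRight x) g
  have hm0 : ∀ u, 0 ≤ m u := fun u =>
    Finset.sum_nonneg fun x _ => mul_nonneg (ha _) (hb _)
  have hsm : ∑ u, m u = A * M := hshift a
  have hrhs : ∑ u, (m u).negMulLog - (A * M).negMulLog
        - M * (∑ x, (a x).negMulLog - A.negMulLog)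
      = ∑ u, ∑ x, a (u + x) * b x * (Real.log (a (u + x)) + Real.log M - Real.log (m u)) := by
    have h1 : ∑ u, ∑ x, a (u + x) * b x * Real.log (m u) = - ∑ u, (m u).negMulLog := by
      simp only [← Finset.sum_mul, Real.negMulLog, neg_mul, Finset.sum_neg_distrib, neg_neg]
      rfl
    have h2 : ∑ u, ∑ x, a (u + x) * b x * Real.log M = A * M * Real.log M := by
      rw [← hsm]
      simp only [Finset.sum_mul, hm]
    have h3 : ∑ u, ∑ x, a (u + x) * b x * Real.log (a (u + x))
        = - (∑ x, (a x).negMulLog) * M := by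
      rw [← Finset.sum_neg_distrib, ← hshift]
      refine Finset.sum_congr rfl fun u _ => Finset.sum_congr rfl fun x _ => ?_
      rw [Real.negMulLog]
      ring
    simp only [mul_sub, mul_add, Finset.sum_sub_distrib, Finset.sum_add_distrib, h1, h2, h3]
    rw [Real.negMulLog_mul, Real.negMulLog, Real.negMulLog]
    ring
  have hsq : ∑ u, ∑ x, b x * (√(a (u + x)) - √(m u / M)) ^ 2
      = ∑ u, ∑ x, 2 * (a (u + x) * b x - b x * (√(a (u + x)) * √(m u / M))) := by
    have h1 : ∀ u x, b x * (√(a (u + x)) - √(m u / M)) ^ 2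
        = 2 * (a (u + x) * b x - b x * (√(a (u + x)) * √(m u / M)))
          + (b x * (m u / M) - a (u + x) * b x) := by
      intro u x
      rw [sub_sq, Real.sq_sqrt (ha _), Real.sq_sqrt (div_nonneg (hm0 _) hM0)]
      ring
    -- Both terms have total mass `A * M`.
    have h2 : ∑ u, ∑ x, (b x * (m u / M) - a (u + x) * b x) = 0 := by
      simp only [Finset.sum_sub_distrib, ← Finset.sum_mul]
      rw [← hM, hshift a, ← hA, ← hsm, sub_eq_zero]
      exact Finset.sum_congr rfl fun u _ => mul_div_cancel₀ _ hMpos.ne'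
    simp only [h1]
    rw [← add_zero (∑ u, ∑ x, 2 * (a (u + x) * b x - b x * (√(a (u + x)) * √(m u / M)))), ← h2]
    simp only [Finset.sum_add_distrib]
  have hvar : ∀ u, 1 / 4 * ∑ x, b x * b (x + d) / M * (√(a (u + x)) - √(a (u + x + d))) ^ 2
      ≤ ∑ x, b x * (√(a (u + x)) - √(m u / M)) ^ 2 := by
    intro u
    have h := sum_mul_shift_sq_le (f := fun x => √(a (u + x))) hb (√(m u / M)) d
    simp only [div_mul_eq_mul_div, ← Finset.sum_div, add_assoc]
    rw [← hM] at h
    rw [one_mul, div_div, div_le_iff₀ (by positivity)]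
    linarith
  have hlhs : (∑ x, b x * b (x + d) / M) * ∑ u, (√(a u) - √(a (u + d))) ^ 2
      = ∑ u, ∑ x, b x * b (x + d) / M * (√(a (u + x)) - √(a (u + x + d))) ^ 2 := by
    rw [Finset.sum_comm, Finset.sum_mul]
    refine Finset.sum_congr rfl fun x _ => ?_
    rw [← Finset.mul_sum]
    congr 1
    exact (Equiv.sum_comp (Equiv.addRight x) (fun u => (√(a u) - √(a (u + d))) ^ 2)).symm
  rw [hrhs, hlhs, Finset.mul_sum]
  refine (Finset.sum_le_sum fun u _ => hvar u).trans (hsq.trans_le ?_)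
  refine Finset.sum_le_sum fun u _ => Finset.sum_le_sum fun x _ => ?_
  exact two_mul_sub_sqrt_le_mul_log (ha _) (hb _) (hbM x)
    (Finset.single_le_sum (f := fun x => a (u + x) * b x)
      (fun x _ => mul_nonneg (ha _) (hb _)) (Finset.mem_univ x))

/-- Cauchy–Schwarz after splitting off the weight `√(W.marginal y)`, whose squares sum to `q` over
`G × W.Out`. Where the marginal vanishes so do the joint values, making division by zero harmless.
-/
lemma Z_sq_le (W : Channel.{u, max u v} G) (d : G) :
    W.Z d ^ 2 ≤ Fintype.card G
      * ∑ y, ∑ x, W.joint x y * W.joint (x + d) y / W.marginal y := by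
  have h := Finset.sum_sq_le_sum_mul_sum_of_sq_le_mul (Finset.univ : Finset (G × W.Out))
    (r := fun p => √(W.joint p.1 p.2 * W.joint (p.1 + d) p.2))
    (f := fun p => W.marginal p.2)
    (g := fun p => W.joint p.1 p.2 * W.joint (p.1 + d) p.2 / W.marginal p.2)
    (fun p _ => W.marginal_nonneg _)
    (fun p _ => div_nonneg (mul_nonneg (W.joint_nonneg _ _) (W.joint_nonneg _ _))
      (W.marginal_nonneg _))
    (fun p _ => by
      refine (Real.sq_sqrt (mul_nonneg (W.joint_nonneg _ _) (W.joint_nonneg _ _))).trans_le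
        (le_of_eq ?_)
      rcases (W.marginal_nonneg p.2).eq_or_lt with h | h
      · have : W.joint p.1 p.2 = 0 :=
          le_antisymm (h ▸ W.joint_le_marginal _ _) (W.joint_nonneg _ _)
        simp [this]
      · rw [mul_div_cancel₀ _ h.ne'])
  simp only [Fintype.sum_prod_type, sum_marginal, Finset.sum_const, Finset.card_univ,
    nsmul_eq_mul, mul_one] at h
  rw [Z_eq_sum_joint]
  rwa [Finset.sum_comm (s := (Finset.univ : Finset G)) (f := fun x y =>
    W.joint x y * W.joint (x + d) y / W.marginal y)] at h

/-- A parameter `Z_d` away from `0` and `1` forces the minus transform to increase the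
conditional entropy. -/
lemma Z_sq_mul_one_sub_Z_le_condEntropy_gap (W : Channel.{u, max u v} G) (d : G) :
    1 / (2 * Fintype.card G) * (W.Z d ^ 2 * (1 - W.Z d))
      ≤ (minus.{u, v} W).condEntropy - W.condEntropy := by
  -- Weighting by `W.marginal y₂`, of total mass `1`, spreads `H(W)` over the output pairs of `W⁻`.
  have hgap : (minus.{u, v} W).condEntropy - W.condEntropy
      = ∑ y₁, ∑ y₂, (∑ u, (∑ x, W.joint (u + x) y₁ * W.joint x y₂).negMulLog
        - (W.marginal y₁ * W.marginal y₂).negMulLog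
        - W.marginal y₂ * (∑ x, (W.joint x y₁).negMulLog - (W.marginal y₁).negMulLog)) := by
    have h1 : (minus.{u, v} W).condEntropy
        = ∑ y₁, ∑ y₂, (∑ u, (∑ x, W.joint (u + x) y₁ * W.joint x y₂).negMulLog
          - (W.marginal y₁ * W.marginal y₂).negMulLog) := by
      have h : (minus.{u, v} W).condEntropy = ∑ y : W.Out × W.Out,
          (∑ u, ((minus.{u, v} W).joint u y).negMulLog
            - ((minus.{u, v} W).marginal y).negMulLog) := by
        rw [condEntropy, Finset.sum_comm, ← Finset.sum_sub_distrib]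
        rfl
      simp only [h, joint_minus.{u, v}, marginal_minus.{u, v}, Fintype.sum_prod_type]
    have h2 : W.condEntropy = ∑ y₁, ∑ y₂, W.marginal y₂
        * (∑ x, (W.joint x y₁).negMulLog - (W.marginal y₁).negMulLog) := by
      simp only [← Finset.sum_mul, sum_marginal, one_mul]
      rw [condEntropy, Finset.sum_comm, ← Finset.sum_sub_distrib]
    rw [h1, h2]
    simp only [← Finset.sum_sub_distrib]
  have hq := card_cast_pos (G := G)
  have hZ := W.Z_sq_le d
  have h1 : 0 ≤ 1 - W.Z d := sub_nonneg.2 (W.Z_le_one d)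
  set S := ∑ y, ∑ x, W.joint x y * W.joint (x + d) y / W.marginal y with hS
  calc 1 / (2 * Fintype.card G) * (W.Z d ^ 2 * (1 - W.Z d))
      ≤ 1 / (2 * Fintype.card G) * (Fintype.card G * S * (1 - W.Z d)) := by gcongr
    _ = 1 / 4 * ((2 * (1 - W.Z d)) * S) := by field_simp; ring
    _ = ∑ y₁, ∑ y₂, 1 / 4 * ((∑ x, W.joint x y₂ * W.joint (x + d) y₂ / W.marginal y₂)
          * ∑ u, (√(W.joint u y₁) - √(W.joint (u + d) y₁)) ^ 2) := by
      rw [W.two_mul_one_sub_Z, Finset.sum_comm, hS, Finset.sum_mul_sum]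
      simp only [Finset.mul_sum (s := (Finset.univ : Finset W.Out)) (a := (1 / 4 : ℝ))]
      refine Finset.sum_congr rfl fun y₁ _ => Finset.sum_congr rfl fun y₂ _ => ?_
      rw [mul_comm (∑ u, (√(W.joint u y₁) - √(W.joint (u + d) y₁)) ^ 2)]
    _ ≤ _ := by
      rw [hgap]
      exact Finset.sum_le_sum fun y₁ _ => Finset.sum_le_sum fun y₂ _ =>
        sum_sqrt_mul_shift_le_entropy_gap (fun x => W.joint_nonneg x y₁)
          (fun x => W.joint_nonneg x y₂) d

/-! ### The random index -/

lemma index_congr {b c : ℕ → Bool} {n : ℕ} (h : ∀ k < n, b k = c k) : index b n = index c n := by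
  induction n with
  | zero => rfl
  | succ n ih =>
    rw [index, index, ih fun k hk => h k (hk.trans n.lt_succ_self), h n n.lt_succ_self]

lemma measurable_index {Ω : Type*} [MeasurableSpace Ω] {B : ℕ → Ω → Bool}
    (hB : ∀ n, Measurable (B n)) (n : ℕ) : Measurable fun ω => index (fun k => B k ω) n := by
  induction n with
  | zero => exact measurable_const
  | succ n ih =>
    exact (measurable_of_countable fun p : ℕ × Bool => 2 * p.1 + p.2.toNat).comp
      (ih.prodMk (hB n))

lemma indepFun_index {Ω : Type*} [MeasurableSpace Ω] {μ : Measure Ω} {B : ℕ → Ω → Bool}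
    (hB : ∀ n, Measurable (B n)) (hind : iIndepFun B μ) (n : ℕ) :
    IndepFun (fun ω => index (fun k => B k ω) n) (B n) μ := by
  have h := hind.indepFun_finset (Finset.range n) {n} (by simp) hB
  have h' := h.comp
    -- The padding value `false` is never read: only bits below `n` enter.
    (φ := fun f => index (fun k => if hk : k ∈ Finset.range n then f ⟨k, hk⟩ else false) n)
    (ψ := fun f => f ⟨n, Finset.mem_singleton_self n⟩) (measurable_of_finite _)
    (measurable_of_finite _)
  convert h' using 1
  · ext ω
    refine index_congr fun k hk => ?_
    simp [hk]
  · rfl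

/-- Averages out the fresh bit, in the role of conditional expectation given the past. -/
lemma lintegral_index_bit {Ω : Type*} [MeasurableSpace Ω] {μ : Measure Ω}
    [IsProbabilityMeasure μ] {B : ℕ → Ω → Bool} (hB : ∀ n, Measurable (B n))
    (hind : iIndepFun B μ) (hfair : ∀ n, μ {ω | B n ω = true} = 1 / 2) (n : ℕ)
    (f : ℕ → Bool → ENNReal) :
    ∫⁻ ω, f (index (fun k => B k ω) n) (B n ω) ∂μ
      = ∫⁻ ω, 2⁻¹ * (f (index (fun k => B k ω) n) true
          + f (index (fun k => B k ω) n) false) ∂μ := by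
  have hI := measurable_index hB n
  have hbit : ∀ c : Bool, μ (B n ⁻¹' {c}) = 2⁻¹ := by
    have ht : μ (B n ⁻¹' {true}) = 2⁻¹ := by
      rw [← one_div]
      exact hfair n
    intro c
    cases c
    · have : B n ⁻¹' {false} = (B n ⁻¹' {true})ᶜ := by
        ext ω
        simp
      rw [this, prob_compl_eq_one_sub (hB n (measurableSet_singleton _)), ht,
        ENNReal.one_sub_inv_two]
    · exact ht
  have hm : ∀ c : Bool, Measurable fun ω => f (index (fun k => B k ω) n) c := fun c =>
    (measurable_from_top (f := fun i => f i c)).comp hI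
  have hmi : ∀ c : Bool, Measurable (Set.indicator (B n ⁻¹' {c}) (fun _ => (1 : ENNReal))) :=
    fun c => measurable_const.indicator (hB n (measurableSet_singleton _))
  have hone : ∀ c : Bool,
      ∫⁻ ω, f (index (fun k => B k ω) n) c * Set.indicator (B n ⁻¹' {c}) (fun _ => 1) ω ∂μ
        = ∫⁻ ω, 2⁻¹ * f (index (fun k => B k ω) n) c ∂μ := by
    intro c
    have hi : IndepFun (fun ω => f (index (fun k => B k ω) n) c)
        (Set.indicator (B n ⁻¹' {c}) (fun _ => (1 : ENNReal))) μ :=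
      (indepFun_index hB hind n).comp (measurable_from_top (f := fun i => f i c))
        (measurable_from_top (f := Set.indicator {c} (fun _ => (1 : ENNReal))))
    refine (lintegral_mul_eq_lintegral_mul_lintegral_of_indepFun (hm c) (hmi c) hi).trans ?_
    rw [lintegral_indicator_const (hB n (measurableSet_singleton _)), one_mul, hbit,
      lintegral_const_mul _ (hm c), mul_comm]
  calc ∫⁻ ω, f (index (fun k => B k ω) n) (B n ω) ∂μ
      = ∫⁻ ω, (f (index (fun k => B k ω) n) true * Set.indicator (B n ⁻¹' {true}) (fun _ => 1) ω
        + f (index (fun k => B k ω) n) false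
          * Set.indicator (B n ⁻¹' {false}) (fun _ => 1) ω) ∂μ := by
        refine lintegral_congr fun ω => ?_
        cases h : B n ω <;> simp [Set.indicator, h]
    _ = _ := by
      refine (lintegral_add_left ((hm true).mul (hmi true)) _).trans ?_
      refine (congrArg₂ (· + ·) (hone true) (hone false)).trans ?_
      refine (lintegral_add_left ((hm true).const_mul _) _).symm.trans ?_
      simp only [mul_add]

lemma synth_index_succ (W : Channel.{u, max u v} G) (b : ℕ → Bool) (n : ℕ) :
    synth.{u, v} W (n + 1) (index b (n + 1))
      = if b n then plus.{u, v} (synth.{u, v} W n (index b n))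
        else minus.{u, v} (synth.{u, v} W n (index b n)) := by
  rw [synth, index]
  cases b n
  · simp
  · have h1 : (2 * index b n + 1) % 2 = 1 := by omega
    have h2 : (2 * index b n + 1) / 2 = index b n := by omega
    simp [h1, h2]

lemma Zproc_nonneg (W : Channel.{u, max u v} G) (d : G) (n : ℕ) (b : ℕ → Bool) :
    0 ≤ Zproc.{u, v} W d n b := Z_nonneg.{u, v} _ d

lemma Zproc_le_one (W : Channel.{u, max u v} G) (d : G) (n : ℕ) (b : ℕ → Bool) :
    Zproc.{u, v} W d n b ≤ 1 := Z_le_one.{u, v} _ d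

lemma Zproc_sq_le_succ (W : Channel.{u, max u v} G) (d : G) (n : ℕ) (b : ℕ → Bool) :
    Zproc.{u, v} W d n b ^ 2 ≤ Zproc.{u, v} W d (n + 1) b := by
  rw [Zproc, Zproc, synth_index_succ]
  split_ifs
  · exact (Z_plus.{u, v} _ d).ge
  · refine le_trans ?_ (Z_le_Z_minus.{u, v} _ d)
    exact pow_le_of_le_one (Z_nonneg.{u, v} _ d) (Z_le_one.{u, v} _ d) two_ne_zero

/-! ### Almost sure polarization -/

/-- The increment of the conditional entropy along the minus branch. -/
noncomputable def entropyGap (W : Channel.{u, max u v} G) : ℝ :=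
  (minus.{u, v} W).condEntropy - W.condEntropy

/-- With `H` the entropy and `g` the gap, the next value is `H + g` or `H - g` with equal
probability, and `((H + g)² + (H - g)²) / 2 = H² + g²`. -/
lemma lintegral_condEntropy_sq_succ {Ω : Type*} [MeasurableSpace Ω] {μ : Measure Ω}
    [IsProbabilityMeasure μ] {B : ℕ → Ω → Bool} (hB : ∀ n, Measurable (B n))
    (hind : iIndepFun B μ) (hfair : ∀ n, μ {ω | B n ω = true} = 1 / 2)
    (W : Channel.{u, max u v} G) (n : ℕ) :
    ∫⁻ ω, ENNReal.ofReal
        ((synth.{u, v} W (n + 1) (index (fun k => B k ω) (n + 1))).condEntropy ^ 2) ∂μ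
      = ∫⁻ ω, ENNReal.ofReal ((synth.{u, v} W n (index (fun k => B k ω) n)).condEntropy ^ 2) ∂μ
        + ∫⁻ ω, ENNReal.ofReal
          (entropyGap.{u, v} (synth.{u, v} W n (index (fun k => B k ω) n)) ^ 2) ∂μ := by
  refine Eq.trans ?_ (lintegral_add_left ((measurable_from_top (f := fun i =>
    ENNReal.ofReal ((synth.{u, v} W n i).condEntropy ^ 2))).comp (measurable_index hB n)) _)
  simp only [Function.comp_apply]
  simp only [synth_index_succ.{u, v}]
  refine (lintegral_index_bit hB hind hfair n (fun i c => ENNReal.ofReal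
    ((if c = true then plus.{u, v} (synth.{u, v} W n i)
      else minus.{u, v} (synth.{u, v} W n i)).condEntropy ^ 2))).trans ?_
  refine lintegral_congr fun ω => ?_
  set V := synth.{u, v} W n (index (fun k => B k ω) n) with hV
  have h := condEntropy_minus_add_plus.{u, v} V
  have h2 : (2⁻¹ : ENNReal) = ENNReal.ofReal 2⁻¹ := by
    rw [ENNReal.ofReal_inv_of_pos two_pos]
    simp
  simp only [if_true, Bool.false_eq_true, if_false]
  rw [← ENNReal.ofReal_add (sq_nonneg _) (sq_nonneg _),
    ← ENNReal.ofReal_add (sq_nonneg _) (sq_nonneg _), h2, ← ENNReal.ofReal_mul (by norm_num)]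
  congr 1
  rw [entropyGap, show (plus.{u, v} V).condEntropy
    = 2 * V.condEntropy - (minus.{u, v} V).condEntropy by linarith]
  ring

/-- Telescoping the second moments bounds the expected sum of squared gaps by `q²`; the sum is
therefore almost surely finite and its terms vanish. -/
lemma ae_tendsto_entropyGap {Ω : Type*} [MeasurableSpace Ω] {μ : Measure Ω}
    [IsProbabilityMeasure μ] {B : ℕ → Ω → Bool} (hB : ∀ n, Measurable (B n))
    (hind : iIndepFun B μ) (hfair : ∀ n, μ {ω | B n ω = true} = 1 / 2)
    (W : Channel.{u, max u v} G) :
    ∀ᵐ ω ∂μ, Tendsto (fun n =>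
      entropyGap.{u, v} (synth.{u, v} W n (index (fun k => B k ω) n))) atTop (𝓝 0) := by
  set g : ℕ → Ω → ENNReal := fun n ω => ENNReal.ofReal
    (entropyGap.{u, v} (synth.{u, v} W n (index (fun k => B k ω) n)) ^ 2) with hg
  have hgm : ∀ n, Measurable (g n) := fun n =>
    (measurable_from_top (f := fun i => ENNReal.ofReal
      (entropyGap.{u, v} (synth.{u, v} W n i) ^ 2))).comp (measurable_index hB n)
  have hsum : ∀ n, ∑ k ∈ Finset.range n, ∫⁻ ω, g k ω ∂μ ≤ ∫⁻ ω, ENNReal.ofReal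
      ((synth.{u, v} W n (index (fun k => B k ω) n)).condEntropy ^ 2) ∂μ := by
    intro n
    induction n with
    | zero => simp
    | succ n ih =>
      rw [lintegral_condEntropy_sq_succ hB hind hfair, Finset.sum_range_succ]
      gcongr
  have hbd : ∀ n, ∑ k ∈ Finset.range n, ∫⁻ ω, g k ω ∂μ
      ≤ ENNReal.ofReal ((Fintype.card G : ℝ) ^ 2) := by
    intro n
    refine (hsum n).trans ?_
    refine (lintegral_mono (g := fun _ => ENNReal.ofReal ((Fintype.card G : ℝ) ^ 2))
      fun ω => ?_).trans (by simp)
    exact ENNReal.ofReal_le_ofReal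
      (pow_le_pow_left₀ (condEntropy_nonneg _) (condEntropy_le_card _) 2)
  have hfin : ∫⁻ ω, ∑' n, g n ω ∂μ ≠ ⊤ := by
    rw [lintegral_tsum fun n => (hgm n).aemeasurable]
    refine ne_top_of_le_ne_top ENNReal.ofReal_ne_top
      (ENNReal.tsum_le_of_sum_range_le hbd)
  filter_upwards [ae_lt_top (Measurable.tsum hgm) hfin] with ω hω
  have h0 := ENNReal.tendsto_atTop_zero_of_tsum_ne_top hω.ne
  have h1 := (ENNReal.tendsto_toReal ENNReal.zero_ne_top).comp h0
  have h2 : Tendsto (fun n =>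
      entropyGap.{u, v} (synth.{u, v} W n (index (fun k => B k ω) n)) ^ 2) atTop (𝓝 0) := by
    refine h1.congr fun n => ?_
    exact ENNReal.toReal_ofReal (sq_nonneg _)
  have h3 := (Real.continuous_sqrt.tendsto 0).comp h2
  rw [Real.sqrt_zero] at h3
  refine (tendsto_zero_iff_abs_tendsto_zero _).2 (h3.congr fun n => ?_)
  exact Real.sqrt_sq_eq_abs _

lemma tendsto_zero_or_one {z : ℕ → ℝ} (h0 : ∀ n, 0 ≤ z n) (h1 : ∀ n, z n ≤ 1)
    (hsq : ∀ n, z n ^ 2 ≤ z (n + 1))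
    (h : Tendsto (fun n => z n ^ 2 * (1 - z n)) atTop (𝓝 0)) :
    Tendsto z atTop (𝓝 0) ∨ Tendsto z atTop (𝓝 1) := by
  -- With `1 / 32`, `z ≥ 1 / 2` forces `1 - z < 1 / 8`, so the next term is at least `(7 / 8)² > 1 /
  -- 2`: the upper half is never left.
  obtain ⟨N, hN⟩ := eventually_atTop.1 (h.eventually_lt_const (show (0 : ℝ) < 1 / 32 by norm_num))
  by_cases hA : ∃ n ≥ N, 1 / 2 ≤ z n
  · right
    obtain ⟨n, hn, hz⟩ := hA
    have hstay : ∀ m ≥ n, 1 / 2 ≤ z m := by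
      intro m hm
      induction m, hm using Nat.le_induction with
      | base => exact hz
      | succ m hm ih =>
        have h2 := hN m (hn.trans hm)
        have h3 : (1 / 4 : ℝ) ≤ z m ^ 2 := by nlinarith
        have h4 : 1 - z m < 1 / 8 := by nlinarith [h1 m]
        have h5 := hsq m
        nlinarith
    have h4 := h.const_mul 4
    rw [mul_zero] at h4
    have h5 : Tendsto (fun m => 1 - z m) atTop (𝓝 0) := by
      refine squeeze_zero' (Eventually.of_forall fun m => sub_nonneg.2 (h1 m)) ?_ h4
      filter_upwards [eventually_ge_atTop n] with m hm
      have h3 : (1 / 4 : ℝ) ≤ z m ^ 2 := by nlinarith [hstay m hm]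
      nlinarith [h1 m]
    simpa using h5.const_sub 1
  · left
    push Not at hA
    have h4 := h.const_mul 2
    rw [mul_zero] at h4
    have h5 : Tendsto (fun m => z m ^ 2) atTop (𝓝 0) := by
      refine squeeze_zero' (Eventually.of_forall fun m => sq_nonneg (z m)) ?_ h4
      filter_upwards [eventually_ge_atTop N] with m hm
      nlinarith [hA m hm, sq_nonneg (z m)]
    have h6 := (Real.continuous_sqrt.tendsto 0).comp h5
    rw [Real.sqrt_zero] at h6
    exact h6.congr fun n => Real.sqrt_sq (h0 n)

lemma ae_tendsto_Zproc {Ω : Type*} [MeasurableSpace Ω] {μ : Measure Ω}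
    [IsProbabilityMeasure μ] {B : ℕ → Ω → Bool} (hB : ∀ n, Measurable (B n))
    (hind : iIndepFun B μ) (hfair : ∀ n, μ {ω | B n ω = true} = 1 / 2)
    (W : Channel.{u, max u v} G) :
    ∀ᵐ ω ∂μ, ∀ d, Tendsto (fun n => Zproc.{u, v} W d n (fun k => B k ω)) atTop (𝓝 0)
      ∨ Tendsto (fun n => Zproc.{u, v} W d n (fun k => B k ω)) atTop (𝓝 1) := by
  filter_upwards [ae_tendsto_entropyGap hB hind hfair W] with ω hω d
  refine tendsto_zero_or_one (fun n => Zproc_nonneg W d n _) (fun n => Zproc_le_one W d n _)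
    (fun n => Zproc_sq_le_succ W d n _) ?_
  have hq := card_cast_pos (G := G)
  have h := hω.const_mul (2 * (Fintype.card G : ℝ))
  rw [mul_zero] at h
  refine squeeze_zero (fun n => mul_nonneg (sq_nonneg _) (sub_nonneg.2 (Zproc_le_one W d n _)))
    (fun n => ?_) h
  have h1 := Z_sq_mul_one_sub_Z_le_condEntropy_gap.{u, v}
    (synth.{u, v} W n (index (fun k => B k ω) n)) d
  rwa [one_div_mul_eq_div, div_le_iff₀' (by positivity)] at h1

/-- Where all the processes `Z_d` converge to `0` or `1`, those with limit `1` form a subgroup. -/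
lemma exists_addSubgroup_limit (W : Channel.{u, max u v} G) (b : ℕ → Bool)
    (h : ∀ d, Tendsto (fun n => Zproc.{u, v} W d n b) atTop (𝓝 0)
      ∨ Tendsto (fun n => Zproc.{u, v} W d n b) atTop (𝓝 1)) :
    ∃ H : AddSubgroup G, ∀ d, d ∈ H ↔ Tendsto (fun n => Zproc.{u, v} W d n b) atTop (𝓝 1) := by
  refine ⟨{ carrier := {d | Tendsto (fun n => Zproc.{u, v} W d n b) atTop (𝓝 1)},
            add_mem' := ?_, zero_mem' := ?_, neg_mem' := ?_ }, fun d => Iff.rfl⟩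
  · intro d e hd he
    refine (h (d + e)).resolve_left fun h0 => ?_
    have h1 := (((hd.const_sub 1).const_mul 2).add ((he.const_sub 1).const_mul 2))
    -- If `Z_{d+e}` tended to `0`, the limit of the triangle inequality would read `1 ≤ 0`.
    have h2 := le_of_tendsto_of_tendsto' (h0.const_sub 1) h1
      (fun n => one_sub_Z_add_le.{u, v} (synth.{u, v} W n (index b n)) d e)
    norm_num at h2
  · exact tendsto_const_nhds.congr fun n => (Z_zero.{u, v} (synth.{u, v} W n (index b n))).symm
  · intro d hd
    exact hd.congr fun n => (Z_neg.{u, v} (synth.{u, v} W n (index b n)) d).symm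

/-! ### The channel of a subgroup -/

lemma synth_induction (P : Channel.{u, max u v} G → Prop)
    (hm : ∀ V, P V → P (minus.{u, v} V)) (hp : ∀ V, P V → P (plus.{u, v} V))
    {W : Channel.{u, max u v} G} (hW : P W) (n i : ℕ) : P (synth.{u, v} W n i) := by
  induction n generalizing i with
  | zero => exact hW
  | succ n ih =>
    rw [synth]
    split_ifs
    · exact hm _ (ih _)
    · exact hp _ (ih _)

/-- The channel that reveals exactly the coset of its input modulo `H`. -/
noncomputable def cosetChannel (H : AddSubgroup G) : Channel.{u, max u v} G :=
  open Classical in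
  { Out := ULift.{v} (G ⧸ H)
    fintypeOut := Fintype.ofFinite _
    prob := fun x y => if y.down = (x : G ⧸ H) then 1 else 0
    prob_nonneg := fun x y => by positivity
    sum_prob := fun x => by
      rw [Finset.sum_eq_single (ULift.up (x : G ⧸ H))]
      · exact if_pos rfl
      · exact fun y _ hy => if_neg fun h => hy (ULift.down_injective h)
      · exact fun h => (h (@Finset.mem_univ _ (Fintype.ofFinite _) _)).elim }

lemma synth_cosetChannel_Z_of_mem (H : AddSubgroup G) {d : G} (hd : d ∈ H) (n i : ℕ) :
    (synth.{u, v} (cosetChannel.{u, v} H) n i).Z d = 1 := by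
  refine synth_induction.{u, v} (fun V => Z.{u, v} V d = 1) (fun V hV => ?_) (fun V hV => ?_) ?_ n i
  · exact le_antisymm (Z_le_one.{u, v} _ d) (hV ▸ Z_le_Z_minus.{u, v} V d)
  · simp only [Z_plus.{u, v}, hV, one_pow]
  · have h := two_mul_one_sub_Z.{u, v} (cosetChannel.{u, v} H) d
    have hx : ∀ (x : G) (y : (cosetChannel.{u, v} H).Out),
        (cosetChannel.{u, v} H).joint (x + d) y = (cosetChannel.{u, v} H).joint x y := by
      intro x y
      have : ((x + d : G) : G ⧸ H) = x := by
        rw [QuotientAddGroup.mk_add, (QuotientAddGroup.eq_zero_iff d).2 hd, add_zero]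
      classical
      exact congrArg (fun z : G ⧸ H => 1 / (Fintype.card G : ℝ) * if y.down = z then 1 else 0) this
    simp only [hx, sub_self, ne_eq, OfNat.ofNat_ne_zero, not_false_eq_true, zero_pow,
      Finset.sum_const_zero] at h
    linarith

/-- `Z_le_Z_minus` points the wrong way to propagate `Z_d = 0`. The invariant used instead is that
each output determines the coset of the input modulo `H`. -/
lemma synth_cosetChannel_Z_of_notMem (H : AddSubgroup G) {d : G} (hd : d ∉ H) (n i : ℕ) :
    (synth.{u, v} (cosetChannel.{u, v} H) n i).Z d = 0 := by
  have key := synth_induction.{u, v}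
    (fun V => ∀ y x x', V.joint x y ≠ 0 → V.joint x' y ≠ 0 → x - x' ∈ H)
    (W := cosetChannel.{u, v} H) (fun V hV => ?_) (fun V hV => ?_) ?_ n i
  · rw [Z_eq_sum_joint]
    refine Finset.sum_eq_zero fun x _ => Finset.sum_eq_zero fun y _ => ?_
    rw [Real.sqrt_eq_zero (mul_nonneg (joint_nonneg _ _ _) (joint_nonneg _ _ _))]
    by_contra hne
    refine hd ?_
    simpa using key y (x + d) x (right_ne_zero_of_mul hne) (left_ne_zero_of_mul hne)
  · intro y x x' hx hx'
    rw [joint_minus.{u, v} V _ y] at hx hx'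
    obtain ⟨a, -, ha⟩ := Finset.exists_ne_zero_of_sum_ne_zero hx
    obtain ⟨a', -, ha'⟩ := Finset.exists_ne_zero_of_sum_ne_zero hx'
    have h1 := hV _ _ _ (left_ne_zero_of_mul ha) (left_ne_zero_of_mul ha')
    have h2 := hV _ _ _ (right_ne_zero_of_mul ha) (right_ne_zero_of_mul ha')
    convert H.sub_mem h1 h2 using 1
    abel
  · intro y x x' hx hx'
    rw [joint_plus.{u, v} V _ y] at hx hx'
    exact hV _ _ _ (right_ne_zero_of_mul hx) (right_ne_zero_of_mul hx')
  · intro y x x' hx hx'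
    have hc : ∀ z, (cosetChannel.{u, v} H).joint z y ≠ 0 → y.down = (z : G ⧸ H) := by
      intro z hz
      by_contra hne
      exact hz (by simp [joint, cosetChannel, hne])
    have h := (hc x' hx').symm.trans (hc x hx)
    rw [QuotientAddGroup.eq] at h
    rwa [sub_eq_neg_add]

end

end Channel

/-! ### Assembly of the theorem -/

theorem mainTheorem3 {G : Type u} [AddCommGroup G] [Fintype G]
    {Ω : Type*} [MeasurableSpace Ω] (μ : Measure Ω) [IsProbabilityMeasure μ]
    (B : ℕ → Ω → Bool) (hB_meas : ∀ n, Measurable (B n))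
    (hB_indep : iIndepFun B μ) (hB_fair : ∀ n, μ {ω | B n ω = true} = 1 / 2) :
    (∀ W : Channel.{u, max u v} G,
      ∃ Zlim : G → Ω → ℝ,
        (∀ d, Measurable (Zlim d)) ∧
        (∀ d ω, Zlim d ω = 0 ∨ Zlim d ω = 1) ∧
        (∀ d, ∀ᵐ ω ∂μ, Tendsto (fun n => W.Zproc d n (fun k => B k ω)) atTop (𝓝 (Zlim d ω))) ∧
        (∀ d d' : G, AddSubgroup.zmultiples d' = AddSubgroup.zmultiples d →
          Zlim d' =ᵐ[μ] Zlim d) ∧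
        (∀ᵐ ω ∂μ, ∃! H : AddSubgroup G, ∀ d : G,
          (d ∈ H → Zlim d ω = 1) ∧ (d ∉ H → Zlim d ω = 0))) ∧
    (∀ H : AddSubgroup G, ∃ W : Channel.{u, max u v} G,
      ∀ᵐ ω ∂μ, ∀ d : G,
        (d ∈ H → Tendsto (fun n => W.Zproc d n (fun k => B k ω)) atTop (𝓝 1)) ∧
        (d ∉ H → Tendsto (fun n => W.Zproc d n (fun k => B k ω)) atTop (𝓝 0))) := by
  classical
  constructor
  · intro W
    -- The indicator of this event is measurable and `{0, 1}`-valued everywhere, even where the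
    -- process diverges, and agrees with any limit `0` or `1`.
    set S : G → Set Ω := fun d =>
      {ω | ∃ N, ∀ n ≥ N, 1 / 2 ≤ Channel.Zproc.{u, v} W d n (fun k => B k ω)} with hS
    have hSm : ∀ d, MeasurableSet (S d) := by
      intro d
      have : S d = ⋃ N, ⋂ n, ⋂ (_ : n ≥ N),
          {ω | 1 / 2 ≤ Channel.Zproc.{u, v} W d n (fun k => B k ω)} := by
        ext ω
        simp [hS]
      rw [this]
      refine MeasurableSet.iUnion fun N => MeasurableSet.iInter fun n =>
        MeasurableSet.iInter fun _ => measurableSet_le measurable_const ?_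
      exact (measurable_from_top (f := fun i => (Channel.synth.{u, v} W n i).Z d)).comp
        (Channel.measurable_index hB_meas n)
    set L : G → Ω → ℝ := fun d => (S d).indicator fun _ => 1 with hL
    have hlim := Channel.ae_tendsto_Zproc.{u, v} hB_meas hB_indep hB_fair W
    have hone : ∀ d ω, Tendsto (fun n => Channel.Zproc.{u, v} W d n (fun k => B k ω)) atTop (𝓝 1)
        → L d ω = 1 := by
      intro d ω h
      refine Set.indicator_of_mem ?_ _
      exact eventually_atTop.1 (h.eventually_const_le (by norm_num))
    have hzero : ∀ d ω, Tendsto (fun n => Channel.Zproc.{u, v} W d n (fun k => B k ω)) atTop (𝓝 0)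
        → L d ω = 0 := by
      intro d ω h
      refine Set.indicator_of_notMem ?_ _
      rintro ⟨N, hN⟩
      have h2 := ge_of_tendsto h (eventually_atTop.2 ⟨N, hN⟩)
      norm_num at h2
    have hsub : ∀ᵐ ω ∂μ, ∃ H : AddSubgroup G, ∀ d : G,
        (d ∈ H → L d ω = 1) ∧ (d ∉ H → L d ω = 0) := by
      filter_upwards [hlim] with ω hω
      obtain ⟨H, hH⟩ := Channel.exists_addSubgroup_limit.{u, v} W _ hω
      exact ⟨H, fun d => ⟨fun hd => hone d ω ((hH d).1 hd),
        fun hd => hzero d ω ((hω d).resolve_right fun h => hd ((hH d).2 h))⟩⟩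
    refine ⟨L, fun d => measurable_const.indicator (hSm d), fun d ω => ?_, fun d => ?_,
      fun d d' hdd' => ?_, ?_⟩
    · by_cases h : ω ∈ S d
      · exact Or.inr (Set.indicator_of_mem h _)
      · exact Or.inl (Set.indicator_of_notMem h _)
    · filter_upwards [hlim] with ω hω
      rcases hω d with h | h
      · rwa [hzero d ω h]
      · rwa [hone d ω h]
    · filter_upwards [hsub] with ω hω
      obtain ⟨H, hH⟩ := hω
      have hmem : d' ∈ H ↔ d ∈ H := by
        rw [← AddSubgroup.zmultiples_le, ← AddSubgroup.zmultiples_le, hdd']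
      by_cases h : d ∈ H
      · rw [(hH d).1 h, (hH d').1 (hmem.2 h)]
      · rw [(hH d).2 h, (hH d').2 fun h' => h (hmem.1 h')]
    · filter_upwards [hsub] with ω hω
      obtain ⟨H, hH⟩ := hω
      -- Uniqueness: a subgroup fitting the limits is recovered as the set where they equal `1`.
      have hiff : ∀ K : AddSubgroup G, (∀ d : G, (d ∈ K → L d ω = 1) ∧ (d ∉ K → L d ω = 0)) →
          ∀ d, d ∈ K ↔ L d ω = 1 := fun K hK d =>
        ⟨(hK d).1, fun h1 => by
          by_contra h
          rw [(hK d).2 h] at h1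
          exact zero_ne_one h1⟩
      refine ⟨H, hH, fun K hK => ?_⟩
      ext d
      rw [hiff K hK, hiff H hH]
  · intro H
    refine ⟨Channel.cosetChannel.{u, v} H,
      Eventually.of_forall fun ω d => ⟨fun hd => ?_, fun hd => ?_⟩⟩
    · exact tendsto_const_nhds.congr fun n =>
        (Channel.synth_cosetChannel_Z_of_mem.{u, v} H hd n _).symm
    · exact tendsto_const_nhds.congr fun n =>
        (Channel.synth_cosetChannel_Z_of_notMem.{u, v} H hd n _).symm
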